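/- Let $A$ be a von Neumann algebra with a faithful normal state $\varphi$, and let $(x_i)_{i\in\mathbb N}$ be a sequence in $A$ whose joint $*$-distribution with respect to $\varphi$ is invariant under permutations: for all $k,n$, all $\sigma\in S_k$, all $1\le i(1),\dots,i(n)\le k$ and all $\varepsilon_1,\dots,\varepsilon_n\in\{1,*\}$, $$\varphi\bigl(x_{i(1)}^{\varepsilon_1}\cdots x_{i(n)}^{\varepsilon_n}\bigr)=\varphi\bigl(x_{\sigma(i(1))}^{\varepsilon_1}\cdots x_{\sigma(i(n))}^{\varepsilon_n}\bigr).$$ (If the $x_i$ are self-adjoint, this is invariance of all moments $\varphi(x_{i(1)}\cdots x_{i(n)})$.) Let $A_\infty$ be the von Neumann subalgebra generated by all $x_i$, let $\varphi_\infty=\varphi|_{A_\infty}$, and let $A_{\mathrm{tail}}=\bigcap_{n\ge1}\mathrm{vN}(x_k\mid k\ge n)$ be the tail algebra. Then there is exactly one $\varphi_\infty$-preserving conditional expectation $E\colon A_\infty\to A_{\mathrm{tail}}$, i.e. exactly one linear map with $E[b]=b$, $E[b_1ab_2]=b_1E[a]b_2$ and $\varphi(E[a])=\varphi(a)$ for all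 $a\in A_\infty$ and $b,b_1,b_2\in A_{\mathrm{tail}}$. Denote by $A_{\mathrm{tail}}\langle X\rangle$ the algebra of $A_{\mathrm{tail}}$-valued polynomials, spanned by the formal expressions $b_0Xb_1X\cdots Xb_m$ with $m\ge0$ and $b_0,\dots,b_m\in A_{\mathrm{tail}}$, where the elements of $A_{\mathrm{tail}}$ need not commute with $X$. Then for all $n\in\mathbb N$, all $p_1,\dots,p_n\in A_{\mathrm{tail}}\langle X\rangle$, all $i(1),\dots,i(n)\in\mathbb N$ and every $l\in\{1,\dots,n\}$ such that $i(r)\ne i(l)$ for all $r\ne l$, $$E\bigl[p_1(x_{i(1)})\cdots p_l(x_{i(l)})\cdots p_n(x_{i(n)})\bigr]=E\bigl[p_1(x_{i(1)})\cdots p_{l-1}(x_{i(l-1)})\,E[p_l(x_{i(l)})]\,p_{l+1}(x_{i(l+1)})\cdots p_n(x_{i(n)})\bigr].$$ -/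

import Mathlib

noncomputable section

namespace TailFactorization

/-! ### Von Neumann algebras generated by a set, and the tail algebra -/

section VonNeumann

variable {H : Type*} [NormedAddCommGroup H] [InnerProductSpace ℂ H] [CompleteSpace H]

/-- The von Neumann algebra on `H` generated by a set `S` of bounded operators: the double
commutant of `S ∪ S*`.  It is the least von Neumann algebra containing `S`, see
`generated_le_iff`. -/
def generated (S : Set (H →L[ℂ] H)) : VonNeumannAlgebra H where
  toStarSubalgebra :=
    StarSubalgebra.centralizer ℂ (StarSubalgebra.centralizer ℂ S : Set (H →L[ℂ] H))
  centralizer_centralizer' := by simp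

theorem coe_generated (S : Set (H →L[ℂ] H)) :
    (generated S : Set (H →L[ℂ] H)) = (S ∪ star S).centralizer.centralizer := by
  change ((StarSubalgebra.centralizer ℂ (StarSubalgebra.centralizer ℂ S : Set (H →L[ℂ] H)) :
    StarSubalgebra ℂ (H →L[ℂ] H)) : Set (H →L[ℂ] H)) = _
  exact StarSubalgebra.coe_centralizer_centralizer ℂ S

theorem subset_generated (S : Set (H →L[ℂ] H)) : S ⊆ (generated S : Set (H →L[ℂ] H)) := by
  rw [coe_generated]
  exact Set.subset_union_left.trans Set.subset_centralizer_centralizer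

theorem generated_le_iff (S : Set (H →L[ℂ] H)) (M : VonNeumannAlgebra H) :
    generated S ≤ M ↔ S ⊆ (M : Set (H →L[ℂ] H)) := by
  constructor
  · intro h
    exact (subset_generated S).trans h
  · intro h
    change (generated S : Set (H →L[ℂ] H)) ⊆ (M : Set (H →L[ℂ] H))
    rw [coe_generated, ← M.centralizer_centralizer]
    refine Set.centralizer_subset (Set.centralizer_subset ?_)
    rintro y (hy | hy)
    · exact h hy
    · have h1 : star y ∈ M := h hy
      simpa using star_mem h1

theorem generated_mono {S T : Set (H →L[ℂ] H)} (h : S ⊆ T) : generated S ≤ generated T :=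
  (generated_le_iff S _).2 (h.trans (subset_generated T))

variable {A : VonNeumannAlgebra H}

/-- `vN(x_k | k ≥ n)`. -/
def vnFrom (x : ℕ → A.toStarSubalgebra) (n : ℕ) : VonNeumannAlgebra H :=
  generated {y | ∃ k, n ≤ k ∧ y = (x k : H →L[ℂ] H)}

/-- The von Neumann algebra `A_∞` generated by the whole sequence (indexed from `0`). -/
def vnAll (x : ℕ → A.toStarSubalgebra) : VonNeumannAlgebra H :=
  generated (Set.range fun k => (x k : H →L[ℂ] H))

/-- The tail algebra `⋂ₙ vN(x_k | k ≥ n)`. -/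
def tailAlgebra (x : ℕ → A.toStarSubalgebra) : VonNeumannAlgebra H where
  toStarSubalgebra := ⨅ n, (vnFrom x n).toStarSubalgebra
  centralizer_centralizer' := by
    refine Set.Subset.antisymm ?_ Set.subset_centralizer_centralizer
    intro y hy
    change y ∈ ((⨅ n, (vnFrom x n).toStarSubalgebra : StarSubalgebra ℂ (H →L[ℂ] H)) :
      Set (H →L[ℂ] H))
    rw [StarSubalgebra.coe_iInf]
    refine Set.mem_iInter.2 fun n => ?_
    rw [VonNeumannAlgebra.coe_toStarSubalgebra, ← (vnFrom x n).centralizer_centralizer]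
    refine Set.centralizer_subset (Set.centralizer_subset ?_) hy
    change ((⨅ n, (vnFrom x n).toStarSubalgebra : StarSubalgebra ℂ (H →L[ℂ] H)) :
      Set (H →L[ℂ] H)) ⊆ _
    rw [StarSubalgebra.coe_iInf]
    exact Set.iInter_subset _ n

theorem mem_tailAlgebra_iff (x : ℕ → A.toStarSubalgebra) (y : H →L[ℂ] H) :
    y ∈ (tailAlgebra x).toStarSubalgebra ↔ ∀ n, y ∈ (vnFrom x n).toStarSubalgebra :=
  StarSubalgebra.mem_iInf

theorem vnAll_le (x : ℕ → A.toStarSubalgebra) :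
    (vnAll x).toStarSubalgebra ≤ A.toStarSubalgebra := by
  refine (generated_le_iff _ A).2 ?_
  rintro _ ⟨k, rfl⟩
  exact (x k).2

theorem tailAlgebra_le (x : ℕ → A.toStarSubalgebra) :
    (tailAlgebra x).toStarSubalgebra ≤ (vnAll x).toStarSubalgebra := by
  intro y hy
  refine generated_mono ?_ ((mem_tailAlgebra_iff x y).1 hy 0)
  rintro _ ⟨k, -, rfl⟩
  exact ⟨k, rfl⟩

/-- The inclusion `A_∞ ⊆ A`. -/
abbrev inclAll (x : ℕ → A.toStarSubalgebra) :
    (vnAll x).toStarSubalgebra →⋆ₐ[ℂ] A.toStarSubalgebra :=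
  StarSubalgebra.inclusion (vnAll_le x)

/-- The inclusion `A_tail ⊆ A_∞`. -/
abbrev inclTail (x : ℕ → A.toStarSubalgebra) :
    (tailAlgebra x).toStarSubalgebra →⋆ₐ[ℂ] (vnAll x).toStarSubalgebra :=
  StarSubalgebra.inclusion (tailAlgebra_le x)

/-- The random variable `x_i`, as an element of `A_∞`. -/
def var (x : ℕ → A.toStarSubalgebra) (i : ℕ) : (vnAll x).toStarSubalgebra :=
  ⟨(x i : H →L[ℂ] H), subset_generated _ ⟨i, rfl⟩⟩

/-! ### Faithful normal states, exchangeability, conditional expectations -/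

/-- `φ` is a faithful normal state on the von Neumann algebra `A`.  Normality is continuity for
the σ-weak (ultraweak) topology, i.e. `φ a = ∑ₙ ⟪ξₙ, a ηₙ⟫` for square-summable sequences of
vectors `ξ`, `η`. -/
structure IsFaithfulNormalState (φ : A.toStarSubalgebra →ₗ[ℂ] ℂ) : Prop where
  map_one : φ 1 = 1
  nonneg : ∀ a, 0 ≤ (φ (star a * a)).re ∧ (φ (star a * a)).im = 0
  faithful : ∀ a, φ (star a * a) = 0 → a = 0
  normal : ∃ ξ η : ℕ → H, Summable (fun n => ‖ξ n‖ ^ 2) ∧ Summable (fun n => ‖η n‖ ^ 2) ∧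
    ∀ a : A.toStarSubalgebra,
      HasSum (fun n => inner ℂ (ξ n) ((a : H →L[ℂ] H) (η n))) (φ a)

/-- The letter `x_i` (for `ε = false`) or `x_i*` (for `ε = true`). -/
def letter (x : ℕ → A.toStarSubalgebra) (i : ℕ) (ε : Bool) : A.toStarSubalgebra :=
  if ε then star (x i) else x i

/-- The joint (`*`-)distribution of the sequence `x` with respect to `φ`, i.e. the collection of
all moments in the `x_i` and their adjoints, is invariant under permutations. -/
def IsExchangeable (φ : A.toStarSubalgebra →ₗ[ℂ] ℂ) (x : ℕ → A.toStarSubalgebra) : Prop :=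
  ∀ (k n : ℕ) (σ : Equiv.Perm (Fin k)) (i : Fin n → Fin k) (ε : Fin n → Bool),
    φ (List.ofFn fun j => letter x (i j) (ε j)).prod =
      φ (List.ofFn fun j => letter x (σ (i j)) (ε j)).prod

/-- For self-adjoint variables, invariance of the plain moments is the same thing. -/
theorem isExchangeable_iff_of_isSelfAdjoint (φ : A.toStarSubalgebra →ₗ[ℂ] ℂ)
    (x : ℕ → A.toStarSubalgebra) (hx : ∀ i, IsSelfAdjoint (x i)) :
    IsExchangeable φ x ↔ ∀ (k n : ℕ) (σ : Equiv.Perm (Fin k)) (i : Fin n → Fin k),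
      φ (List.ofFn fun j => x (i j)).prod = φ (List.ofFn fun j => x (σ (i j))).prod := by
  have h : ∀ i ε, letter x i ε = x i := by
    intro i ε
    cases ε
    · rfl
    · exact hx i
  simp only [IsExchangeable, h]
  exact ⟨fun H k n σ i => H k n σ i fun _ => false, fun H k n σ i _ => H k n σ i⟩

/-- `E : A_∞ → A_tail` is a `φ_∞`-preserving conditional expectation onto the tail algebra,
where `φ_∞` is the restriction of `φ` to `A_∞`. -/
structure IsTailCondExp (φ : A.toStarSubalgebra →ₗ[ℂ] ℂ) (x : ℕ → A.toStarSubalgebra)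
    (E : (vnAll x).toStarSubalgebra →ₗ[ℂ] (tailAlgebra x).toStarSubalgebra) : Prop where
  map_tail : ∀ b, E (inclTail x b) = b
  bimodule : ∀ b₁ a b₂, E (inclTail x b₁ * a * inclTail x b₂) = b₁ * E a * b₂
  preserving : ∀ a, φ (inclAll x (inclTail x (E a))) = φ (inclAll x a)

end VonNeumann

/-! ### `B`-valued polynomials in one variable -/

section Polynomials

variable (B : Type*) [Ring B] [Algebra ℂ B]

/-- The relations making the generators `some b` multiply and add as in `B`; the generator `none`
is the variable `X`, subject to no relation. -/
inductive PolyRel : FreeAlgebra ℂ (Option B) → FreeAlgebra ℂ (Option B) → Prop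
  | add (b c : B) : PolyRel (FreeAlgebra.ι ℂ (some (b + c)))
      (FreeAlgebra.ι ℂ (some b) + FreeAlgebra.ι ℂ (some c))
  | mul (b c : B) : PolyRel (FreeAlgebra.ι ℂ (some (b * c)))
      (FreeAlgebra.ι ℂ (some b) * FreeAlgebra.ι ℂ (some c))
  | scalar (z : ℂ) : PolyRel (FreeAlgebra.ι ℂ (some (algebraMap ℂ B z)))
      (algebraMap ℂ (FreeAlgebra ℂ (Option B)) z)

/-- The algebra `B⟨X⟩` of `B`-valued polynomials: the algebra freely generated by `B` and one
variable `X`, spanned by the `b₀ X b₁ X ⋯ X bₙ`. -/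
abbrev OpPoly : Type _ := RingQuot (PolyRel B)

variable {B}

/-- The constant polynomial `b`. -/
def OpPoly.const (b : B) : OpPoly B :=
  RingQuot.mkAlgHom ℂ (PolyRel B) (FreeAlgebra.ι ℂ (some b))

variable (B) in
/-- The variable `X`. -/
def OpPoly.X : OpPoly B := RingQuot.mkAlgHom ℂ (PolyRel B) (FreeAlgebra.ι ℂ none)

/-- Evaluation `p ↦ p(a)` at an element `a` of an algebra `C` into which `B` is mapped by `f`. -/
def OpPoly.eval {C : Type*} [Ring C] [Algebra ℂ C] (f : B →ₐ[ℂ] C) (a : C) :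
    OpPoly B →ₐ[ℂ] C :=
  RingQuot.liftAlgHom ℂ ⟨FreeAlgebra.lift ℂ fun o => o.elim a f, by
    intro p q h
    cases h <;> simp⟩

theorem OpPoly.eval_const {C : Type*} [Ring C] [Algebra ℂ C] (f : B →ₐ[ℂ] C) (a : C) (b : B) :
    OpPoly.eval f a (OpPoly.const b) = f b := by
  simp [OpPoly.eval, OpPoly.const]

theorem OpPoly.eval_X {C : Type*} [Ring C] [Algebra ℂ C] (f : B →ₐ[ℂ] C) (a : C) :
    OpPoly.eval f a (OpPoly.X B) = a := by
  simp [OpPoly.eval, OpPoly.X]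

end Polynomials

section Evaluation

variable {H : Type*} [NormedAddCommGroup H] [InnerProductSpace ℂ H] [CompleteSpace H]
  {A : VonNeumannAlgebra H}

/-- The element `p(x_i)` of `A_∞`, for a tail-algebra-valued polynomial `p`. -/
def polyAt (x : ℕ → A.toStarSubalgebra) (p : OpPoly (tailAlgebra x).toStarSubalgebra) (i : ℕ) :
    (vnAll x).toStarSubalgebra :=
  OpPoly.eval (inclTail x : (tailAlgebra x).toStarSubalgebra →ₐ[ℂ] (vnAll x).toStarSubalgebra)
    (var x i) p

end Evaluation

end TailFactorization

end

/-!
The idea is to handle substitutions of the indices through their graphs.  For an injection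
`g : ℕ → ℕ`, let `pairs (op x) (op x ∘ g)` be the set of all `(a, b)` such that `a ⊕ b` lies in the
von Neumann algebra on `H ⊕ H` generated by the operators `x k ⊕ x (g k)`.  The normal functional
`a ⊕ b ↦ φ a - φ b` vanishes on words in the generators, by exchangeability, hence on the whole von
Neumann algebra, by the double commutant theorem (`normalFunctional_eq_zero_of_mem_generated`).  So
`φ a = φ b` for all pairs (`normalFunctional_eq_of_mem_pairs`), and since `φ` is faithful, `b` is
determined by `a` (`snd_eq_of_mem_pairs`).  Conversely every `a ∈ A_∞` occurs in a pair `(a, b)`,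
with a bound on `‖b‖` that does not depend on `g` (`exists_mem_pairs`): for a unitary `a`, the
operator `a ⊕ b` is obtained as a partial isometry commuting with the commutant, and the unitaries
span.

The tail algebra is fixed by finite substitutions and by shifts: `(s, s)` is a pair for every tail
element `s` (`diag_mem_pairs_of_eventually_fixed`, `shift_mem_pairs_of_mem_tailAlgebra`).  For
`a ∈ A_∞`, the shifts `aₙ ∈ vN(x_k | k ≥ n)` of `a` are bounded, a weak limit point `b` of them lies
in the tail algebra, and `φ (s a t) = φ (s aₙ t) → φ (s b t)` for all tail elements `s`, `t`.  By
faithfulness this property determines `b`; the map `a ↦ b` is the conditional expectation, and every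
`φ`-preserving conditional expectation has this property.

For the factorization, exchange the index `i` of the distinguished factor with a large index `j`.
This fixes the other factors and the tail elements and replaces `p(x_i)` by `p(x_j)`.  The sequence
`p(x_j)` is bounded, and its weak limit points are `E[p(x_i)]` by the characterization of `E`; letting
`j → ∞` in `φ (s w₁ p(x_i) w₂ t) = φ (s w₁ p(x_j) w₂ t)` gives the claim
(`IsTailCondExp.map_mul_polyAt_mul`).
-/

noncomputable section

namespace TailFactorization

open Filter Topology
open scoped InnerProductSpace

section DoubleCommutant

/-! ### Normal functionals and the double commutant -/

variable {H K : Type*} [NormedAddCommGroup H] [InnerProductSpace ℂ H]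
  [NormedAddCommGroup K] [InnerProductSpace ℂ K]

theorem memℓp_apply (T : H →L[ℂ] K) (ζ : lp (fun _ : ℕ => H) 2) :
    Memℓp (fun n => T (ζ n)) 2 := by
  have h := lp.memℓp ζ
  rw [memℓp_gen_iff (by norm_num)] at h ⊢
  simp only [ENNReal.toReal_ofNat, Real.rpow_ofNat] at h ⊢
  refine Summable.of_nonneg_of_le (fun n => by positivity) (fun n => ?_) (h.mul_left (‖T‖ ^ 2))
  rw [← mul_pow]
  exact pow_le_pow_left₀ (norm_nonneg _) (T.le_opNorm _) 2

/-- The amplification `T ⊕ T ⊕ ⋯` of a bounded operator `T : H → K`, between the Hilbert sums of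
countably many copies of `H` and of `K`. -/
def amplify (T : H →L[ℂ] K) : lp (fun _ : ℕ => H) 2 →L[ℂ] lp (fun _ : ℕ => K) 2 :=
  LinearMap.mkContinuous
    { toFun := fun ζ => ⟨fun n => T (ζ n), memℓp_apply T ζ⟩
      map_add' := fun ζ θ => Subtype.ext <| funext fun n => T.map_add _ _
      map_smul' := fun c ζ => Subtype.ext <| funext fun n => T.map_smul _ _ }
    ‖T‖ fun ζ => by
      refine lp.norm_le_of_forall_sum_le (by norm_num) (by positivity) fun s => ?_
      simp only [ENNReal.toReal_ofNat, Real.rpow_ofNat]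
      calc ∑ n ∈ s, ‖T (ζ n)‖ ^ 2 ≤ ∑ n ∈ s, ‖T‖ ^ 2 * ‖ζ n‖ ^ 2 := by
            refine Finset.sum_le_sum fun n _ => ?_
            rw [← mul_pow]
            exact pow_le_pow_left₀ (norm_nonneg _) (T.le_opNorm _) 2
        _ = ‖T‖ ^ 2 * ∑ n ∈ s, ‖ζ n‖ ^ 2 := by rw [Finset.mul_sum]
        _ ≤ ‖T‖ ^ 2 * ‖ζ‖ ^ 2 := by
            gcongr
            have := lp.sum_rpow_le_norm_rpow (p := 2) (by norm_num) ζ s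
            simpa using this
        _ = (‖T‖ * ‖ζ‖) ^ 2 := by ring

@[simp]
theorem amplify_apply (T : H →L[ℂ] K) (ζ : lp (fun _ : ℕ => H) 2) (n : ℕ) :
    amplify T ζ n = T (ζ n) := rfl

theorem amplify_single (T : H →L[ℂ] K) (n : ℕ) (h : H) :
    amplify T (lp.single 2 n h) = lp.single 2 n (T h) := by
  ext m
  rw [amplify_apply, lp.single_apply, lp.single_apply]
  by_cases hm : m = n
  · subst hm; simp
  · simp [hm]

/-- The normal functional `T ↦ ∑ ⟪ξ n, T (η n)⟫`. -/
def normalFunctional (ξ η : lp (fun _ : ℕ => H) 2) : (H →L[ℂ] H) →ₗ[ℂ] ℂ where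
  toFun T := ⟪ξ, amplify T η⟫_ℂ
  map_add' S T := by
    rw [show amplify (S + T) η = amplify S η + amplify T η by ext n; simp, inner_add_right]
  map_smul' c T := by
    rw [show amplify (c • T) η = c • amplify T η by ext n; simp, inner_smul_right]
    rfl

theorem normalFunctional_apply (ξ η : lp (fun _ : ℕ => H) 2) (T : H →L[ℂ] H) :
    normalFunctional ξ η T = ∑' n, ⟪ξ n, T (η n)⟫_ℂ :=
  lp.inner_eq_tsum _ _

theorem normalFunctional_mul (ξ η : lp (fun _ : ℕ => H) 2) (S T : H →L[ℂ] H) :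
    normalFunctional ξ η (S * T) = normalFunctional ξ (amplify T η) S := rfl

variable [CompleteSpace H]

theorem mem_generated_iff {S : Set (H →L[ℂ] H)} {a : H →L[ℂ] H} :
    a ∈ generated S ↔ ∀ r ∈ (S ∪ star S).centralizer, r * a = a * r := by
  change a ∈ (generated S : Set (H →L[ℂ] H)) ↔ _
  rw [coe_generated, Set.mem_centralizer_iff]

/-- A normal functional vanishing on the `*`-algebra generated by `S`
vanishes on the von Neumann algebra generated by `S`.  This is the double commutant theorem for
the countable amplification: the projection onto the closure of the `T η` commutes with the
amplified generators, hence has matrix coefficients in the commutant, hence commutes with the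
amplification of the double commutant. -/
theorem normalFunctional_eq_zero_of_mem_generated {S : Set (H →L[ℂ] H)}
    (ξ η : lp (fun _ : ℕ => H) 2)
    (h : ∀ T ∈ Algebra.adjoin ℂ (S ∪ star S), normalFunctional ξ η T = 0)
    {a : H →L[ℂ] H} (ha : a ∈ generated S) : normalFunctional ξ η a = 0 := by
  have amp_inner : ∀ (T : H →L[ℂ] H) ζ θ, ⟪amplify T ζ, θ⟫_ℂ = ⟪ζ, amplify (star T) θ⟫_ℂ := by
    intro T ζ θ
    rw [lp.inner_eq_tsum, lp.inner_eq_tsum]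
    refine tsum_congr fun n => ?_
    rw [amplify_apply, amplify_apply, ContinuousLinearMap.star_eq_adjoint,
      ContinuousLinearMap.adjoint_inner_right]
  let V : Submodule ℂ (lp (fun _ : ℕ => H) 2) :=
    { carrier := {ζ | ∃ T ∈ Algebra.adjoin ℂ (S ∪ star S), ζ = amplify T η}
      zero_mem' := ⟨0, zero_mem _, by ext n; simp⟩
      add_mem' := by
        rintro _ _ ⟨T, hT, rfl⟩ ⟨T', hT', rfl⟩
        exact ⟨T + T', add_mem hT hT', by ext n; simp⟩
      smul_mem' := by
        rintro c _ ⟨T, hT, rfl⟩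
        exact ⟨c • T, Subalgebra.smul_mem _ hT c, by ext n; simp [lp.coeFn_smul]⟩ }
  let W := V.topologicalClosure
  have : CompleteSpace W := V.isClosed_topologicalClosure.completeSpace_coe
  let Q : lp (fun _ : ℕ => H) 2 →L[ℂ] lp (fun _ : ℕ => H) 2 := W.starProjection
  have ampW : ∀ T ∈ S ∪ star S, ∀ ζ ∈ W, amplify T ζ ∈ W := by
    intro T hT ζ hζ
    refine map_mem_closure (amplify T).continuous hζ ?_
    rintro _ ⟨T', hT', rfl⟩
    exact ⟨T * T', mul_mem (Algebra.subset_adjoin hT) hT', by ext n; simp⟩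
  have starS : ∀ T ∈ S ∪ star S, star T ∈ S ∪ star S := by
    rintro T (hT | hT)
    · exact Or.inr (by simpa using hT)
    · exact Or.inl hT
  have Qcomm : ∀ T ∈ S ∪ star S, ∀ ζ, Q (amplify T ζ) = amplify T (Q ζ) := by
    intro T hT ζ
    refine Submodule.eq_starProjection_of_mem_of_inner_eq_zero
      (ampW T hT _ (Submodule.starProjection_apply_mem W ζ)) ?_
    intro w hw
    rw [← map_sub, amp_inner]
    exact Submodule.starProjection_inner_eq_zero ζ _ (ampW _ (starS T hT) w hw)
  have Qcoeff : ∀ m n : ℕ, ((lp.evalCLM ℂ (fun _ : ℕ => H) 2 m) ∘L Q ∘L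
      (lp.singleContinuousLinearMap ℂ (fun _ : ℕ => H) 2 n)) ∈ (S ∪ star S).centralizer := by
    intro m n T hT
    ext h
    change T (Q (lp.single 2 n h) m) = Q (lp.single 2 n (T h)) m
    rw [← amplify_single, Qcomm T hT, amplify_apply]
  have Qa : Q ∘L amplify a = amplify a ∘L Q := by
    refine lp.ext_continuousLinearMap (by norm_num) fun n => ?_
    ext h m
    have := DFunLike.congr_fun (mem_generated_iff.1 ha _ (Qcoeff m n)) h
    change Q (lp.single 2 n (a h)) m = a (Q (lp.single 2 n h) m) at this
    change Q (amplify a (lp.single 2 n h)) m = amplify a (Q (lp.single 2 n h)) m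
    rw [amplify_single, this, amplify_apply]
  have hη : η ∈ W := V.le_topologicalClosure ⟨1, one_mem _, by ext n; simp⟩
  have haη : amplify a η ∈ W := by
    have h1 : Q (amplify a η) = amplify a (Q η) := DFunLike.congr_fun Qa η
    rw [show Q η = η from Submodule.starProjection_eq_self_iff.2 hη] at h1
    rw [← h1]
    exact Submodule.starProjection_apply_mem W _
  have hclosed : W ≤ (ℂ ∙ ξ)ᗮ := by
    refine V.topologicalClosure_minimal ?_ (Submodule.isClosed_orthogonal _)
    rintro _ ⟨T, hT, rfl⟩
    rw [Submodule.mem_orthogonal_singleton_iff_inner_right]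
    exact h T hT
  exact Submodule.mem_orthogonal_singleton_iff_inner_right.1 (hclosed haη)

end DoubleCommutant

section WeakLimit

/-! ### Weak limits along an ultrafilter -/

variable {H : Type*} [NormedAddCommGroup H] [InnerProductSpace ℂ H] [CompleteSpace H]

/-- A bounded family of operators converges in the weak operator topology along every
ultrafilter. -/
theorem exists_tendsto_inner_of_bounded {ι : Type*} (U : Ultrafilter ι) (T : ι → H →L[ℂ] H)
    {C : ℝ} (hT : ∀ i, ‖T i‖ ≤ C) :
    ∃ b : H →L[ℂ] H, ∀ ξ η, Tendsto (fun i => ⟪ξ, T i η⟫_ℂ) U (𝓝 ⟪ξ, b η⟫_ℂ) := by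
  have bound : ∀ i ξ η, ‖⟪ξ, T i η⟫_ℂ‖ ≤ C * ‖ξ‖ * ‖η‖ := by
    intro i ξ η
    calc ‖⟪ξ, T i η⟫_ℂ‖ ≤ ‖ξ‖ * ‖T i η‖ := norm_inner_le_norm _ _
      _ ≤ ‖ξ‖ * (C * ‖η‖) := by gcongr; exact (T i).le_of_opNorm_le (hT i) η
      _ = C * ‖ξ‖ * ‖η‖ := by ring
  have key : ∀ ξ η, ∃ z : ℂ, ‖z‖ ≤ C * ‖ξ‖ * ‖η‖ ∧
      Tendsto (fun i => ⟪ξ, T i η⟫_ℂ) U (𝓝 z) := by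
    intro ξ η
    have hc : IsCompact (Metric.closedBall (0 : ℂ) (C * ‖ξ‖ * ‖η‖)) := isCompact_closedBall _ _
    obtain ⟨z, hz, hz'⟩ := hc.ultrafilter_le_nhds (U.map fun i => ⟪ξ, T i η⟫_ℂ) (by
      rw [Filter.le_principal_iff]
      exact Filter.mem_map.2 (Filter.univ_mem' fun i => by simpa using bound i ξ η))
    exact ⟨z, by simpa using hz, hz'⟩
  choose B hB hlim using key
  let B' : H →L⋆[ℂ] H →L[ℂ] ℂ := LinearMap.mkContinuous₂
    (LinearMap.mk₂'ₛₗ (starRingEnd ℂ) (RingHom.id ℂ) B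
      (fun ξ ξ' η => tendsto_nhds_unique (hlim _ _) (by
        simpa only [inner_add_left] using (hlim ξ η).add (hlim ξ' η)))
      (fun c ξ η => tendsto_nhds_unique (hlim _ _) (by
        simpa only [inner_smul_left, smul_eq_mul] using (hlim ξ η).const_mul _))
      (fun ξ η η' => tendsto_nhds_unique (hlim _ _) (by
        simpa only [map_add, inner_add_right] using (hlim ξ η).add (hlim ξ η')))
      (fun c ξ η => tendsto_nhds_unique (hlim _ _) (by
        simpa only [map_smul, inner_smul_right, RingHom.id_apply, smul_eq_mul] using
          (hlim ξ η).const_mul _))) C hB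
  refine ⟨ContinuousLinearMap.adjoint (InnerProductSpace.continuousLinearMapOfBilin B'),
    fun ξ η => ?_⟩
  rw [ContinuousLinearMap.adjoint_inner_right,
    InnerProductSpace.continuousLinearMapOfBilin_apply]
  exact hlim ξ η

/-- Von Neumann algebras are closed under weak limits. -/
theorem mem_of_tendsto_inner {ι : Type*} {l : Filter ι} [l.NeBot] {M : VonNeumannAlgebra H}
    {T : ι → H →L[ℂ] H} {b : H →L[ℂ] H}
    (hb : ∀ ξ η, Tendsto (fun i => ⟪ξ, T i η⟫_ℂ) l (𝓝 ⟪ξ, b η⟫_ℂ)) (hT : ∀ᶠ i in l, T i ∈ M) :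
    b ∈ M := by
  change b ∈ (M : Set (H →L[ℂ] H))
  rw [← M.centralizer_centralizer, Set.mem_centralizer_iff]
  intro r hr
  ext η
  refine ext_inner_left ℂ fun ξ => ?_
  have h1 := hb (ContinuousLinearMap.adjoint r ξ) η
  simp only [ContinuousLinearMap.adjoint_inner_left] at h1
  refine tendsto_nhds_unique h1 ((hb ξ (r η)).congr' ?_)
  filter_upwards [hT] with i hi
  exact congrArg (fun S : H →L[ℂ] H => ⟪ξ, S η⟫_ℂ) ((Set.mem_centralizer_iff.1 hr) (T i) hi)

/-- Normal functionals are weakly continuous on bounded families. -/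
theorem tendsto_normalFunctional {ι : Type*} {l : Filter ι} (ξ η : lp (fun _ : ℕ => H) 2)
    {T : ι → H →L[ℂ] H} {b : H →L[ℂ] H} {C : ℝ} (hC : ∀ i, ‖T i‖ ≤ C)
    (hb : ∀ ξ η, Tendsto (fun i => ⟪ξ, T i η⟫_ℂ) l (𝓝 ⟪ξ, b η⟫_ℂ)) (s t : H →L[ℂ] H) :
    Tendsto (fun i => normalFunctional ξ η (s * T i * t)) l
      (𝓝 (normalFunctional ξ η (s * b * t))) := by
  have hsum : ∀ ζ : lp (fun _ : ℕ => H) 2, Summable fun n => ‖ζ n‖ ^ 2 := by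
    intro ζ
    have h := lp.memℓp ζ
    rw [memℓp_gen_iff (by norm_num)] at h
    simpa using h
  have hξ := hsum ξ
  have hη := hsum η
  simp only [normalFunctional_apply]
  refine tendsto_tsum_of_dominated_convergence
    (bound := fun n => ‖s‖ * C * ‖t‖ * (‖ξ n‖ ^ 2 + ‖η n‖ ^ 2))
    ((hξ.add hη).mul_left _) (fun n => ?_) (.of_forall fun i n => ?_)
  · have := hb (ContinuousLinearMap.adjoint s (ξ n)) (t (η n))
    simp only [ContinuousLinearMap.adjoint_inner_left] at this
    exact this
  · have hC0 : 0 ≤ C := (norm_nonneg _).trans (hC i)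
    calc ‖⟪ξ n, (s * T i * t) (η n)⟫_ℂ‖ ≤ ‖ξ n‖ * (‖s * T i * t‖ * ‖η n‖) :=
          (norm_inner_le_norm _ _).trans (by gcongr; exact ContinuousLinearMap.le_opNorm _ _)
      _ ≤ ‖ξ n‖ * (‖s‖ * C * ‖t‖ * ‖η n‖) := by
          gcongr
          refine (norm_mul_le _ _).trans ?_
          gcongr
          refine (norm_mul_le _ _).trans ?_
          gcongr
          exact hC i
      _ = ‖s‖ * C * ‖t‖ * (‖ξ n‖ * ‖η n‖) := by ring
      _ ≤ ‖s‖ * C * ‖t‖ * (‖ξ n‖ ^ 2 + ‖η n‖ ^ 2) := by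
          gcongr
          nlinarith [sq_nonneg (‖ξ n‖ - ‖η n‖), sq_nonneg ‖ξ n‖, sq_nonneg ‖η n‖]

end WeakLimit

section DiagonalPairs

/-! ### Operators on `H ⊕ H` that are diagonal -/

variable {H : Type*} [NormedAddCommGroup H] [InnerProductSpace ℂ H]

/-- The block diagonal operator `a ⊕ b` on the Hilbert sum `H ⊕ H`. -/
def dsum (a b : H →L[ℂ] H) : WithLp 2 (H × H) →L[ℂ] WithLp 2 (H × H) :=
  (WithLp.prodContinuousLinearEquiv 2 ℂ H H).symm.toContinuousLinearMap ∘L (a.prodMap b) ∘L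
    (WithLp.prodContinuousLinearEquiv 2 ℂ H H).toContinuousLinearMap

theorem dsum_apply (a b : H →L[ℂ] H) (k : WithLp 2 (H × H)) :
    dsum a b k = WithLp.toLp 2 (a k.fst, b k.snd) := rfl

theorem dsum_mul (a b a' b' : H →L[ℂ] H) : dsum a b * dsum a' b' = dsum (a * a') (b * b') := rfl

variable (H) in
/-- The first inclusion `H → H ⊕ H`. -/
def inlL : H →L[ℂ] WithLp 2 (H × H) :=
  (WithLp.prodContinuousLinearEquiv 2 ℂ H H).symm.toContinuousLinearMap ∘L
    ContinuousLinearMap.inl ℂ H H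

variable (H) in
/-- The second inclusion `H → H ⊕ H`. -/
def inrL : H →L[ℂ] WithLp 2 (H × H) :=
  (WithLp.prodContinuousLinearEquiv 2 ℂ H H).symm.toContinuousLinearMap ∘L
    ContinuousLinearMap.inr ℂ H H

theorem dsum_inlL (a b : H →L[ℂ] H) (h : H) : dsum a b (inlL H h) = inlL H (a h) :=
  congrArg (WithLp.toLp 2) (Prod.ext rfl b.map_zero)

theorem dsum_inrL (a b : H →L[ℂ] H) (h : H) : dsum a b (inrL H h) = inrL H (b h) :=
  congrArg (WithLp.toLp 2) (Prod.ext a.map_zero rfl)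

theorem eq_inlL_add_inrL (k : WithLp 2 (H × H)) : k = inlL H k.fst + inrL H k.snd :=
  congrArg (WithLp.toLp 2) (Prod.ext (add_zero k.fst).symm (zero_add k.snd).symm)

theorem normalFunctional_dsum (ξ η : lp (fun _ : ℕ => H) 2) (a b : H →L[ℂ] H) :
    normalFunctional (amplify (inlL H - inrL H) ξ) (amplify (inlL H + inrL H) η) (dsum a b) =
      normalFunctional ξ η a - normalFunctional ξ η b := by
  have ha : Summable fun n => ⟪ξ n, a (η n)⟫_ℂ := lp.summable_inner ξ (amplify a η)
  have hb : Summable fun n => ⟪ξ n, b (η n)⟫_ℂ := lp.summable_inner ξ (amplify b η)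
  rw [normalFunctional_apply, normalFunctional_apply ξ, normalFunctional_apply ξ,
    ← ha.tsum_sub hb]
  refine tsum_congr fun n => ?_
  rw [amplify_apply, amplify_apply, add_apply, map_add, dsum_inlL, dsum_inrL, sub_apply]
  generalize ξ n = u
  rw [WithLp.prod_inner_apply]
  simp [inlL, inrL, sub_eq_add_neg]

variable [CompleteSpace H]

theorem star_dsum (a b : H →L[ℂ] H) : star (dsum a b) = dsum (star a) (star b) := by
  symm
  rw [ContinuousLinearMap.star_eq_adjoint (dsum a b), ContinuousLinearMap.eq_adjoint_iff]
  intro k k'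
  simp [dsum_apply, WithLp.prod_inner_apply, ContinuousLinearMap.star_eq_adjoint,
    ContinuousLinearMap.adjoint_inner_left]

/-- `dsum` as a homomorphism of `*`-algebras. -/
def dsumHom : ((H →L[ℂ] H) × (H →L[ℂ] H)) →⋆ₐ[ℂ]
    (WithLp 2 (H × H) →L[ℂ] WithLp 2 (H × H)) where
  toFun p := dsum p.1 p.2
  map_one' := rfl
  map_mul' _ _ := rfl
  map_zero' := rfl
  map_add' _ _ := rfl
  commutes' _ := rfl
  map_star' p := (star_dsum p.1 p.2).symm

/-- The pairs `(a, b)` for which `a ⊕ b` lies in the von Neumann algebra generated by the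
`y i ⊕ z i`.  When `y i ↦ z i` extends to a normal homomorphism, this is its graph. -/
def pairs {ι : Type*} (y z : ι → H →L[ℂ] H) : StarSubalgebra ℂ ((H →L[ℂ] H) × (H →L[ℂ] H)) :=
  (generated (Set.range fun i => dsum (y i) (z i))).toStarSubalgebra.comap dsumHom

theorem mem_pairs_iff {ι : Type*} {y z : ι → H →L[ℂ] H} {p : (H →L[ℂ] H) × (H →L[ℂ] H)} :
    p ∈ pairs y z ↔ dsum p.1 p.2 ∈ generated (Set.range fun i => dsum (y i) (z i)) := Iff.rfl

theorem apply_mem_pairs {ι : Type*} (y z : ι → H →L[ℂ] H) (i : ι) : (y i, z i) ∈ pairs y z :=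
  mem_pairs_iff.2 (subset_generated _ ⟨i, rfl⟩)

section

variable {ι : Type*} {y z : ι → H →L[ℂ] H} {a a' b b' : H →L[ℂ] H}

theorem one_mem_pairs : ((1 : H →L[ℂ] H), (1 : H →L[ℂ] H)) ∈ pairs y z := by
  rw [Prod.mk_one_one]
  exact one_mem _

theorem add_mem_pairs (h : (a, b) ∈ pairs y z) (h' : (a', b') ∈ pairs y z) :
    (a + a', b + b') ∈ pairs y z := by
  rw [← Prod.mk_add_mk]
  exact add_mem h h'

theorem mul_mem_pairs (h : (a, b) ∈ pairs y z) (h' : (a', b') ∈ pairs y z) :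
    (a * a', b * b') ∈ pairs y z := by
  rw [← Prod.mk_mul_mk]
  exact mul_mem h h'

theorem smul_mem_pairs (c : ℂ) (h : (a, b) ∈ pairs y z) : (c • a, c • b) ∈ pairs y z := by
  rw [← Prod.smul_mk]
  exact SMulMemClass.smul_mem c h

theorem star_mem_pairs (h : (a, b) ∈ pairs y z) : (star a, star b) ∈ pairs y z := by
  have := star_mem h
  rwa [Prod.star_def] at this

end

theorem pairs_le_pairs {ι κ : Type*} {y z : ι → H →L[ℂ] H} {y' z' : κ → H →L[ℂ] H}
    (h : ∀ i, (y i, z i) ∈ pairs y' z') : pairs y z ≤ pairs y' z' := by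
  intro p hp
  refine mem_pairs_iff.2 ((generated_le_iff _ _).2 ?_ (mem_pairs_iff.1 hp))
  rintro _ ⟨i, rfl⟩
  exact h i

/-- Commutation with a family of operators and their adjoints, in terms of the family. -/
theorem mem_centralizer_range_iff {ι : Type*} {y : ι → H →L[ℂ] H} {r : H →L[ℂ] H} :
    r ∈ (Set.range y ∪ star (Set.range y)).centralizer ↔
      ∀ i, y i * r = r * y i ∧ star (y i) * r = r * star (y i) := by
  rw [Set.mem_centralizer_iff]
  constructor
  · exact fun h i => ⟨h _ (Or.inl ⟨i, rfl⟩), h _ (Or.inr ⟨i, by simp⟩)⟩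
  · rintro h _ (⟨i, rfl⟩ | ⟨i, hi⟩)
    · exact (h i).1
    · rw [eq_comm, star_eq_iff_star_eq] at hi
      rw [← hi]
      exact (h i).2

/-- The second component of a pair lies in the von Neumann algebra generated by the second
components. -/
theorem snd_mem_generated_of_mem_pairs {ι : Type*} {y z : ι → H →L[ℂ] H} {a b : H →L[ℂ] H}
    (h : (a, b) ∈ pairs y z) : b ∈ generated (Set.range z) := by
  rw [mem_generated_iff]
  intro r hr
  rw [mem_centralizer_range_iff] at hr
  have h0 : dsum 0 r ∈ (Set.range (fun i => dsum (y i) (z i)) ∪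
      star (Set.range fun i => dsum (y i) (z i))).centralizer := by
    rw [mem_centralizer_range_iff]
    intro i
    simp only [star_dsum, dsum_mul, (hr i).1, (hr i).2, mul_zero, zero_mul, and_self]
  have := mem_generated_iff.1 (mem_pairs_iff.1 h) _ h0
  ext ζ
  simpa [dsum_apply] using congrArg WithLp.snd (DFunLike.congr_fun this (WithLp.toLp 2 (0, ζ)))

/-- If all `(u k, u k)` are pairs, so are all `(a, a)` with `a` in the von Neumann algebra generated
by the `u k`: the matrix coefficients of an operator commuting with all `u k ⊕ u k` commute with all
`u k`. -/
theorem diag_mem_pairs {ι κ : Type*} {y z : ι → H →L[ℂ] H} {u : κ → H →L[ℂ] H}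
    (hu : ∀ k, (u k, u k) ∈ pairs y z) {a : H →L[ℂ] H} (ha : a ∈ generated (Set.range u)) :
    (a, a) ∈ pairs y z := by
  rw [mem_pairs_iff, mem_generated_iff]
  intro r hr
  have hcomm : ∀ k, dsum (u k) (u k) * r = r * dsum (u k) (u k) ∧
      dsum (star (u k)) (star (u k)) * r = r * dsum (star (u k)) (star (u k)) := fun k =>
    ⟨((mem_generated_iff.1 (mem_pairs_iff.1 (hu k))) r hr).symm,
      ((mem_generated_iff.1 (mem_pairs_iff.1 (star_mem (hu k)))) r hr).symm⟩
  have coeff : ∀ (P : WithLp 2 (H × H) →L[ℂ] H) (J : H →L[ℂ] WithLp 2 (H × H)),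
      (∀ c k, P (dsum c c k) = c (P k)) → (∀ c h, dsum c c (J h) = J (c h)) →
      ∀ h, P (r (J (a h))) = a (P (r (J h))) := by
    intro P J hP hJ h
    refine DFunLike.congr_fun (mem_generated_iff.1 ha (P ∘L r ∘L J) ?_) h
    rw [mem_centralizer_range_iff]
    intro k
    constructor
    · ext h
      change u k (P (r (J h))) = P (r (J (u k h)))
      rw [← hP, ← hJ]
      exact congrArg P (DFunLike.congr_fun (hcomm k).1 (J h))
    · ext h
      change star (u k) (P (r (J h))) = P (r (J (star (u k) h)))
      rw [← hP, ← hJ]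
      exact congrArg P (DFunLike.congr_fun (hcomm k).2 (J h))
  ext1 k
  change r (dsum a a k) = dsum a a (r k)
  rw [eq_inlL_add_inrL k]
  simp only [map_add, dsum_inlL, dsum_inrL]
  generalize k.fst = h1
  generalize k.snd = h2
  have e1 : ∀ (J : H →L[ℂ] WithLp 2 (H × H)), (∀ c h, dsum c c (J h) = J (c h)) →
      ∀ h, r (J (a h)) = dsum a a (r (J h)) := by
    intro J hJ h
    apply (WithLp.equiv 2 (H × H)).injective
    exact Prod.ext (coeff (WithLp.fstL 2 ℂ H H) J (fun _ _ => rfl) hJ h)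
      (coeff (WithLp.sndL 2 ℂ H H) J (fun _ _ => rfl) hJ h)
  rw [e1 _ fun c => dsum_inlL c c, e1 _ fun c => dsum_inrL c c]

end DiagonalPairs

section Lifting

/-! ### Lifting elements to pairs -/

variable {E K : Type*} [AddCommGroup E] [Module ℂ E]
  [NormedAddCommGroup K] [InnerProductSpace ℂ K] [CompleteSpace K]

/-- If `‖L' f‖ ≤ C ‖L f‖` for all `f`, then `L f ↦ L' f` extends to a bounded operator vanishing
on the orthogonal complement of the range of `L`. -/
theorem exists_clm_of_norm_le (L L' : E →ₗ[ℂ] K) {C : ℝ} (hC : 0 ≤ C)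
    (h : ∀ f, ‖L' f‖ ≤ C * ‖L f‖) :
    ∃ T : K →L[ℂ] K, (∀ f, T (L f) = L' f) ∧ (∀ k ∈ (LinearMap.range L)ᗮ, T k = 0) ∧
      ‖T‖ ≤ C := by
  let W := (LinearMap.range L).topologicalClosure
  have : CompleteSpace W := (LinearMap.range L).isClosed_topologicalClosure.completeSpace_coe
  let e : E →ₗ[ℂ] W := L.codRestrict W fun f =>
    (LinearMap.range L).le_topologicalClosure (LinearMap.mem_range_self L f)
  have hd : DenseRange e := by
    intro w
    rw [closure_subtype]
    have : ((↑) '' Set.range e : Set K) = LinearMap.range L := by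
      ext k; simp [e]
    rw [this]
    exact w.2
  have hn : ∀ f, ‖L' f‖ ≤ C * ‖e f‖ := h
  refine ⟨(L'.extendOfNorm e) ∘L W.orthogonalProjectionOnto, fun f => ?_, fun k hk => ?_, ?_⟩
  · have : W.orthogonalProjectionOnto (L f) = e f :=
      Submodule.orthogonalProjectionOnto_mem_subspace_eq_self (e f)
    rw [ContinuousLinearMap.comp_apply, this, LinearMap.extendOfNorm_eq hd ⟨C, hn⟩]
  · have : W.orthogonalProjectionOnto k = 0 := by
      rw [Submodule.orthogonalProjectionOnto_eq_zero_iff, Submodule.orthogonal_closure]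
      exact hk
    rw [ContinuousLinearMap.comp_apply, this, map_zero]
  · calc _ ≤ ‖L'.extendOfNorm e‖ * ‖W.orthogonalProjectionOnto‖ :=
          ContinuousLinearMap.opNorm_comp_le _ _
      _ ≤ C * 1 := by
          gcongr
          · exact LinearMap.opNorm_extendOfNorm_le hd hC hn
          · exact W.orthogonalProjectionOnto_norm_le
      _ = C := mul_one C

/-- An isometry `u` in the von Neumann algebra generated by the `y i` is the first component of a
pair.  On vectors `s (h, 0)` with `s` in the commutant of the `y i ⊕ z i`, the second component is
forced through `s (h, 0) ↦ s (u h, 0)`; this is isometric because the upper left corners of the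
operators `s'⋆ s` commute with `u`. -/
theorem exists_mem_pairs_of_isometry {ι : Type*} {H : Type*} [NormedAddCommGroup H]
    [InnerProductSpace ℂ H] [CompleteSpace H] {y : ι → H →L[ℂ] H} (z : ι → H →L[ℂ] H)
    {u : H →L[ℂ] H} (hu : u ∈ generated (Set.range y)) (hu1 : star u * u = 1) :
    ∃ b, (u, b) ∈ pairs y z ∧ ‖b‖ ≤ 1 := by
  let G := Set.range fun i => dsum (y i) (z i)
  let R := (G ∪ star G).centralizer
  have hRmul : ∀ {r s}, r ∈ R → s ∈ R → r * s ∈ R := fun hr hs => Set.mul_mem_centralizer hr hs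
  have hRstar : ∀ {r}, r ∈ R → star r ∈ R := fun hr => Set.star_mem_centralizer hr
  let Φ : (H →L[ℂ] H) → (R →₀ H) →ₗ[ℂ] WithLp 2 (H × H) := fun c =>
    Finsupp.lsum ℂ fun s : R => ((s : WithLp 2 (H × H) →L[ℂ] WithLp 2 (H × H)) ∘L inlL H ∘L
      c).toLinearMap
  have hΦ : ∀ c f, Φ c f = f.sum fun s h => (s : WithLp 2 (H × H) →L[ℂ] WithLp 2 (H × H))
      (inlL H (c h)) := fun _ _ => rfl
  -- upper left corners of the commutant commute with `u`
  have corner : ∀ r ∈ R, ∀ h, (r (inlL H (u h))).fst = u (r (inlL H h)).fst := by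
    intro r hr h
    have hr' := mem_centralizer_range_iff.1 hr
    refine DFunLike.congr_fun (mem_generated_iff.1 hu
      (WithLp.fstL 2 ℂ H H ∘L r ∘L inlL H) ?_) h
    rw [mem_centralizer_range_iff]
    intro i
    constructor
    · ext h
      have := DFunLike.congr_fun (hr' i).1 (inlL H h)
      change dsum (y i) (z i) (r (inlL H h)) = r (dsum (y i) (z i) (inlL H h)) at this
      rw [dsum_inlL] at this
      exact congrArg WithLp.fst this
    · ext h
      have := DFunLike.congr_fun (hr' i).2 (inlL H h)
      rw [star_dsum] at this
      change dsum (star (y i)) (star (z i)) (r (inlL H h)) =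
        r (dsum (star (y i)) (star (z i)) (inlL H h)) at this
      rw [dsum_inlL] at this
      exact congrArg WithLp.fst this
  have inner_inlL : ∀ (h : H) (k : WithLp 2 (H × H)), ⟪inlL H h, k⟫_ℂ = ⟪h, k.fst⟫_ℂ := by
    intro h k
    rw [WithLp.prod_inner_apply]
    change ⟪h, k.fst⟫_ℂ + ⟪(0 : H), k.snd⟫_ℂ = _
    rw [inner_zero_left, add_zero]
  have hinner : ∀ r ∈ R, ∀ s ∈ R, ∀ h h',
      ⟪r (inlL H (u h)), s (inlL H (u h'))⟫_ℂ = ⟪r (inlL H h), s (inlL H h')⟫_ℂ := by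
    intro r hr s hs h h'
    have hrs : star r * s ∈ R := hRmul (hRstar hr) hs
    have e : ∀ k k', ⟪r k, s k'⟫_ℂ = ⟪k, (star r * s) k'⟫_ℂ := by
      intro k k'
      change _ = ⟪k, star r (s k')⟫_ℂ
      rw [ContinuousLinearMap.star_eq_adjoint, ContinuousLinearMap.adjoint_inner_right]
    rw [e, e, inner_inlL, inner_inlL, corner _ hrs, ← ContinuousLinearMap.adjoint_inner_right]
    refine congrArg _ ?_
    exact DFunLike.congr_fun hu1 _
  have hnorm : ∀ f, ‖Φ u f‖ ≤ 1 * ‖Φ 1 f‖ := by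
    intro f
    have : (⟪Φ u f, Φ u f⟫_ℂ) = ⟪Φ 1 f, Φ 1 f⟫_ℂ := by
      simp only [hΦ, Finsupp.sum_inner, Finsupp.inner_sum, hinner _ (Subtype.prop _) _
        (Subtype.prop _)]
      rfl
    rw [inner_self_eq_norm_sq_to_K, inner_self_eq_norm_sq_to_K] at this
    have h2 : ‖Φ u f‖ ^ 2 = ‖Φ 1 f‖ ^ 2 := by exact_mod_cast this
    rw [one_mul, (sq_eq_sq₀ (norm_nonneg _) (norm_nonneg _)).1 h2]
  obtain ⟨T, hT, hT0, hT1⟩ := exists_clm_of_norm_le (Φ 1) (Φ u) zero_le_one hnorm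
  have hcomm : ∀ r ∈ R, ∀ k, r (T k) = T (r k) := by
    intro r hr
    let W := (LinearMap.range (Φ 1)).topologicalClosure
    have : CompleteSpace W := (LinearMap.range (Φ 1)).isClosed_topologicalClosure.completeSpace_coe
    have hΦr : ∀ r, ∀ hr : r ∈ R, ∀ c f, ∃ f', r (Φ c f) = Φ c f' ∧ ∀ c', r (Φ c' f) = Φ c' f' := by
      intro r hr c f
      let f' : R →₀ H := f.mapDomain fun s : R => ⟨r * s.1, hRmul hr s.2⟩
      have : ∀ c', r (Φ c' f) = Φ c' f' := by
        intro c'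
        rw [hΦ, hΦ, Finsupp.sum_mapDomain_index (by simp) (by simp), map_finsuppSum]
        rfl
      exact ⟨f', this c, this⟩
    have h1 : ∀ k ∈ W, r (T k) = T (r k) := by
      intro k hk
      have hcl : IsClosed {k | r (T k) = T (r k)} := isClosed_eq (by fun_prop) (by fun_prop)
      refine closure_minimal ?_ hcl hk
      rintro _ ⟨f, rfl⟩
      obtain ⟨f', h1, h2⟩ := hΦr r hr 1 f
      change r (T (Φ 1 f)) = T (r (Φ 1 f))
      rw [hT, h1, hT, h2]
    have h2 : ∀ k ∈ (LinearMap.range (Φ 1))ᗮ, r (T k) = T (r k) := by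
      intro k hk
      rw [hT0 k hk, map_zero, hT0 _ ?_]
      rw [Submodule.mem_orthogonal] at hk ⊢
      rintro _ ⟨f, rfl⟩
      obtain ⟨f', h1, h2⟩ := hΦr _ (hRstar hr) 1 f
      rw [← ContinuousLinearMap.adjoint_inner_left, ← ContinuousLinearMap.star_eq_adjoint, h1]
      exact hk _ ⟨f', rfl⟩
    intro k
    obtain ⟨v, hv, w, hw, rfl⟩ := W.exists_add_mem_mem_orthogonal k
    rw [Submodule.orthogonal_closure] at hw
    simp only [map_add, h1 v hv, h2 w hw]
  have hTinl : ∀ h, T (inlL H h) = inlL H (u h) := by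
    intro h
    have := hT (Finsupp.single ⟨1, Set.one_mem_centralizer⟩ h)
    simpa [hΦ] using this
  -- `T` commutes with the projection onto the second summand, so it is block diagonal
  have hproj : dsum 0 1 ∈ R := by
    refine mem_centralizer_range_iff.2 fun i => ?_
    simp only [star_dsum, dsum_mul, mul_zero, zero_mul, mul_one, one_mul, and_self]
  let b : H →L[ℂ] H := WithLp.sndL 2 ℂ H H ∘L T ∘L inrL H
  have hTinr : ∀ h, T (inrL H h) = inrL H (b h) := by
    intro h
    have := hcomm _ hproj (inrL H h)
    rw [dsum_inrL] at this
    exact this.symm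
  have hTb : T = dsum u b := by
    ext1 k
    rw [eq_inlL_add_inrL k, map_add, map_add, dsum_inlL, dsum_inrL, hTinl, hTinr]
  refine ⟨b, ?_, ?_⟩
  · rw [mem_pairs_iff, ← hTb, mem_generated_iff]
    intro r hr
    ext1 k
    exact hcomm r hr k
  · refine ContinuousLinearMap.opNorm_le_bound _ zero_le_one fun h => ?_
    have h1 : ‖(WithLp.snd (T (inrL H h)))‖ ≤ ‖T (inrL H h)‖ := WithLp.norm_snd_le _ _
    have h2 : ‖inrL H h‖ = ‖h‖ := by
      change ‖WithLp.toLp 2 ((0 : H), h)‖ = _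
      simp
    calc ‖b h‖ ≤ ‖T (inrL H h)‖ := h1
      _ ≤ 1 * ‖inrL H h‖ := T.le_of_opNorm_le hT1 _
      _ = 1 * ‖h‖ := by rw [h2]

/-- A von Neumann algebra is spanned by its unitaries, of which only `u⋆ u = 1` is recorded. -/
theorem mem_span_isometries {H : Type*} [NormedAddCommGroup H]
    [InnerProductSpace ℂ H] [CompleteSpace H] {M : VonNeumannAlgebra H} {a : H →L[ℂ] H}
    (ha : a ∈ M) : a ∈ Submodule.span ℂ {u : H →L[ℂ] H | u ∈ M ∧ star u * u = 1} := by
  let N := M.toStarSubalgebra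
  have hN : IsClosed (N : Set (H →L[ℂ] H)) := by
    change IsClosed (M : Set (H →L[ℂ] H))
    rw [← M.centralizer_centralizer]
    exact Set.isClosed_centralizer _
  have hspan : (⟨a, ha⟩ : N) ∈ Submodule.span ℂ (unitary N : Set N) := by
    rw [CStarAlgebra.span_unitary]
    exact Submodule.mem_top
  have h1 := Submodule.apply_mem_span_image_of_mem_span N.subtype.toLinearMap hspan
  refine Submodule.span_mono ?_ h1
  rintro _ ⟨u, hu, rfl⟩
  have h2 : star u * u = 1 := Unitary.star_mul_self_of_mem hu
  have h3 : N.subtype (star u * u) = 1 := by rw [h2, map_one]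
  rw [map_mul, map_star] at h3
  exact ⟨u.2, h3⟩

/-- Every element of the von Neumann algebra generated by the `y i` is the first component of a
pair, with a bound on the second component that does not depend on the `z i`. -/
theorem exists_mem_pairs {ι : Type*} {H : Type*} [NormedAddCommGroup H]
    [InnerProductSpace ℂ H] [CompleteSpace H] {y : ι → H →L[ℂ] H} {a : H →L[ℂ] H}
    (ha : a ∈ generated (Set.range y)) :
    ∃ C : ℝ, ∀ z : ι → H →L[ℂ] H, ∃ b, (a, b) ∈ pairs y z ∧ ‖b‖ ≤ C := by
  have hspan := mem_span_isometries ha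
  clear ha
  induction hspan using Submodule.span_induction with
  | mem u hu => exact ⟨1, fun z => exists_mem_pairs_of_isometry z hu.1 hu.2⟩
  | zero => exact ⟨0, fun z => ⟨0, by rw [Prod.mk_zero_zero]; exact zero_mem _, by simp⟩⟩
  | add m m' _ _ h h' =>
    obtain ⟨C, hC⟩ := h
    obtain ⟨C', hC'⟩ := h'
    refine ⟨C + C', fun z => ?_⟩
    obtain ⟨b, hb, hbC⟩ := hC z
    obtain ⟨b', hb', hbC'⟩ := hC' z
    exact ⟨b + b', add_mem_pairs hb hb', (norm_add_le _ _).trans (add_le_add hbC hbC')⟩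
  | smul c m _ h =>
    obtain ⟨C, hC⟩ := h
    refine ⟨‖c‖ * C, fun z => ?_⟩
    obtain ⟨b, hb, hbC⟩ := hC z
    exact ⟨c • b, smul_mem_pairs c hb, by rw [norm_smul]; gcongr⟩

end Lifting

section Exchangeable

/-! ### Exchangeability on graphs of index substitutions -/

variable {H : Type*} [NormedAddCommGroup H] [InnerProductSpace ℂ H] [CompleteSpace H]
  {A : VonNeumannAlgebra H} {φ : A.toStarSubalgebra →ₗ[ℂ] ℂ} {x : ℕ → A.toStarSubalgebra}
  {ξ η : lp (fun _ : ℕ => H) 2}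

/-- The sequence `x` as operators on `H`. -/
def op (x : ℕ → A.toStarSubalgebra) (k : ℕ) : H →L[ℂ] H := x k

theorem vnFrom_eq (x : ℕ → A.toStarSubalgebra) (n : ℕ) :
    vnFrom x n = generated (Set.range fun k => op x (n + k)) := by
  unfold vnFrom
  congr 1
  ext y
  constructor
  · rintro ⟨k, hk, rfl⟩
    exact ⟨k - n, by simp only [Nat.add_sub_cancel' hk]; rfl⟩
  · rintro ⟨k, rfl⟩
    exact ⟨n + k, Nat.le_add_right _ _, rfl⟩

theorem vnFrom_anti (x : ℕ → A.toStarSubalgebra) {m n : ℕ} (h : m ≤ n) :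
    vnFrom x n ≤ vnFrom x m :=
  generated_mono fun _ ⟨k, hk, hy⟩ => ⟨k, h.trans hk, hy⟩

theorem vnFrom_le_vnAll (x : ℕ → A.toStarSubalgebra) (n : ℕ) : vnFrom x n ≤ vnAll x :=
  generated_mono fun _ ⟨k, _, hy⟩ => ⟨k, hy.symm⟩

theorem IsFaithfulNormalState.exists_normalFunctional (hφ : IsFaithfulNormalState φ) :
    ∃ ξ η : lp (fun _ : ℕ => H) 2, ∀ a : A.toStarSubalgebra,
      normalFunctional ξ η (a : H →L[ℂ] H) = φ a := by
  obtain ⟨ξ, η, hξ, hη, h⟩ := hφ.normal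
  have hmem : ∀ ζ : ℕ → H, Summable (fun n => ‖ζ n‖ ^ 2) → Memℓp ζ 2 := fun ζ hζ => by
    rw [memℓp_gen_iff (by norm_num)]
    simpa using hζ
  exact ⟨⟨ξ, hmem ξ hξ⟩, ⟨η, hmem η hη⟩, fun a => by
    rw [normalFunctional_apply]
    exact (h a).tsum_eq⟩

/-- An injection between subsets of a finite set is the restriction of a permutation. -/
theorem exists_perm_apply_eq {ι α : Type*} [Finite α] (f g : ι → α) (hf : Function.Injective f)
    (hg : Function.Injective g) : ∃ σ : Equiv.Perm α, ∀ i, σ (f i) = g i := by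
  classical
  have := Fintype.ofFinite α
  let e : {a // a ∈ Set.range f} ≃ {a // a ∈ Set.range g} :=
    (Equiv.ofInjective f hf).symm.trans (Equiv.ofInjective g hg)
  refine ⟨e.extendSubtype, fun i => ?_⟩
  rw [e.extendSubtype_apply_of_mem (f i) ⟨i, rfl⟩]
  have : (Equiv.ofInjective f hf).symm ⟨f i, ⟨i, rfl⟩⟩ = i := Equiv.ofInjective_symm_apply hf i
  change ((Equiv.ofInjective g hg) ((Equiv.ofInjective f hf).symm ⟨f i, ⟨i, rfl⟩⟩) : α) = g i
  rw [this]
  rfl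

/-- Exchangeability, for an arbitrary injective substitution of the indices. -/
theorem IsExchangeable.map_word_eq (hx : IsExchangeable φ x) {g : ℕ → ℕ}
    (hg : Function.Injective g) (w : List (ℕ × Bool)) :
    φ (w.map fun p => letter x p.1 p.2).prod = φ (w.map fun p => letter x (g p.1) p.2).prod := by
  classical
  obtain ⟨k, hk⟩ : ∃ k, ∀ p ∈ w, p.1 < k ∧ g p.1 < k := by
    induction w with
    | nil => exact ⟨0, by simp⟩
    | cons p w ih =>
      obtain ⟨k, hk⟩ := ih
      refine ⟨k + p.1 + g p.1 + 1, fun q hq => ?_⟩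
      rcases List.mem_cons.1 hq with rfl | hq
      · omega
      · have := hk q hq
        omega
  let s := {m // ∃ p ∈ w, p.1 = m}
  have hs : ∀ m : s, m.1 < k ∧ g m.1 < k := by
    rintro ⟨m, p, hp, rfl⟩
    exact hk p hp
  obtain ⟨σ, hσ⟩ := exists_perm_apply_eq (fun m : s => (⟨m.1, (hs m).1⟩ : Fin k))
    (fun m : s => (⟨g m.1, (hs m).2⟩ : Fin k))
    (fun m m' h => Subtype.ext (congrArg Fin.val h))
    (fun m m' h => Subtype.ext (hg (congrArg Fin.val h)))
  have h := hx k w.length σ (fun j => ⟨w[j].1, (hk _ (List.getElem_mem _)).1⟩) (fun j => w[j].2)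
  have hσ' : ∀ j : Fin w.length,
      (σ ⟨w[j].1, (hk _ (List.getElem_mem _)).1⟩ : ℕ) = g w[j].1 := fun j =>
    congrArg Fin.val (hσ ⟨w[j].1, _, List.getElem_mem _, rfl⟩)
  simp only [hσ'] at h
  have e : ∀ F : ℕ × Bool → A.toStarSubalgebra,
      List.ofFn (fun j : Fin w.length => F w[j]) = w.map F := by
    intro F
    refine List.ext_getElem (by simp) fun n h1 h2 => by simp
  exact (congrArg (fun l => φ l.prod) (e fun p => letter x p.1 p.2)).symm.trans
    (h.trans (congrArg (fun l => φ l.prod) (e fun p => letter x (g p.1) p.2)))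

/-- Exchangeability passes to the von Neumann algebra generated by the `x k ⊕ x (g k)`: the graph
of the substitution `g` is `φ`-preserving. -/
theorem normalFunctional_eq_of_mem_pairs (hx : IsExchangeable φ x)
    (hω : ∀ a : A.toStarSubalgebra, normalFunctional ξ η (a : H →L[ℂ] H) = φ a)
    {g : ℕ → ℕ} (hg : Function.Injective g) {a b : H →L[ℂ] H}
    (h : (a, b) ∈ pairs (op x) (op x ∘ g)) :
    normalFunctional ξ η a = normalFunctional ξ η b := by
  -- the functional `T₁ ⊕ T₂ ↦ ω T₁ - ω T₂`
  let Λ := normalFunctional (amplify (inlL H - inrL H) ξ) (amplify (inlL H + inrL H) η)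
  have hΛ : ∀ a b, Λ (dsum a b) = normalFunctional ξ η a - normalFunctional ξ η b :=
    normalFunctional_dsum ξ η
  have h0 := normalFunctional_eq_zero_of_mem_generated
    (amplify (inlL H - inrL H) ξ) (amplify (inlL H + inrL H) η) ?_ (mem_pairs_iff.1 h)
  · exact sub_eq_zero.1 ((hΛ a b).symm.trans h0)
  intro T hT
  rw [← Subalgebra.mem_toSubmodule, Algebra.adjoin_eq_span] at hT
  suffices h : ∀ T ∈ Submonoid.closure (Set.range (fun i => dsum (op x i) ((op x ∘ g) i)) ∪
      star (Set.range fun i => dsum (op x i) ((op x ∘ g) i))), T ∈ LinearMap.ker Λ by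
    exact LinearMap.mem_ker.1 (Submodule.span_le.2 h hT)
  intro T hT
  obtain ⟨w, rfl⟩ : ∃ w : List (ℕ × Bool), T =
      dsum ((w.map fun p => letter x p.1 p.2).prod : A.toStarSubalgebra)
        ((w.map fun p => letter x (g p.1) p.2).prod : A.toStarSubalgebra) := by
    induction hT using Submonoid.closure_induction with
    | mem T hT =>
      rcases hT with ⟨i, rfl⟩ | ⟨i, hi⟩
      · exact ⟨[(i, false)], by simp [letter, op]⟩
      · rw [eq_comm, star_eq_iff_star_eq] at hi
        refine ⟨[(i, true)], ?_⟩
        rw [← hi, star_dsum]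
        simp [letter, op]
    | one => exact ⟨[], rfl⟩
    | mul T T' _ _ h h' =>
      obtain ⟨w, rfl⟩ := h
      obtain ⟨w', rfl⟩ := h'
      exact ⟨w ++ w', by simp [dsum_mul]⟩
  rw [LinearMap.mem_ker, hΛ, hω, hω, hx.map_word_eq hg, sub_self]

/-- The second component of a pair is determined by the first, by faithfulness of the state. -/
theorem snd_eq_of_mem_pairs (hφ : IsFaithfulNormalState φ) (hx : IsExchangeable φ x)
    (hω : ∀ a : A.toStarSubalgebra, normalFunctional ξ η (a : H →L[ℂ] H) = φ a)
    {g : ℕ → ℕ} (hg : Function.Injective g) {a b b' : H →L[ℂ] H}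
    (h : (a, b) ∈ pairs (op x) (op x ∘ g)) (h' : (a, b') ∈ pairs (op x) (op x ∘ g)) :
    b = b' := by
  have h0 : ((0 : H →L[ℂ] H), b - b') ∈ pairs (op x) (op x ∘ g) := by
    have := sub_mem h h'
    rwa [Prod.mk_sub_mk, sub_self] at this
  have hA : b - b' ∈ A.toStarSubalgebra := by
    refine (generated_le_iff _ A).2 ?_ (snd_mem_generated_of_mem_pairs h0)
    rintro _ ⟨k, rfl⟩
    exact (x (g k)).2
  have h1 : ((0 : H →L[ℂ] H), star (b - b') * (b - b')) ∈ pairs (op x) (op x ∘ g) := by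
    simpa only [mul_zero] using mul_mem_pairs (star_mem_pairs h0) h0
  have h2 := normalFunctional_eq_of_mem_pairs hx hω hg h1
  rw [map_zero] at h2
  have h3 := hφ.faithful ⟨b - b', hA⟩ (by rw [← hω]; exact h2.symm)
  exact sub_eq_zero.1 (congrArg Subtype.val h3)

end Exchangeable

section TailAlgebra

/-! ### The tail algebra and the limit expectation -/

variable {H : Type*} [NormedAddCommGroup H] [InnerProductSpace ℂ H] [CompleteSpace H]
  {A : VonNeumannAlgebra H} {φ : A.toStarSubalgebra →ₗ[ℂ] ℂ} {x : ℕ → A.toStarSubalgebra}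
  {ξ η : lp (fun _ : ℕ => H) 2}

theorem mem_of_mem_vnAll {a : H →L[ℂ] H} (ha : a ∈ vnAll x) : a ∈ A.toStarSubalgebra :=
  vnAll_le x ha

theorem mem_vnFrom_of_mem_tailAlgebra {s : H →L[ℂ] H} (hs : s ∈ tailAlgebra x) (n : ℕ) :
    s ∈ vnFrom x n :=
  (mem_tailAlgebra_iff x s).1 hs n

theorem mem_vnAll_of_mem_tailAlgebra {s : H →L[ℂ] H} (hs : s ∈ tailAlgebra x) : s ∈ vnAll x :=
  tailAlgebra_le x hs

/-- Tail elements are fixed by index substitutions that move only finitely many indices. -/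
theorem diag_mem_pairs_of_eventually_fixed {g : ℕ → ℕ} {N : ℕ} (hg : ∀ k, N ≤ k → g k = k)
    {s : H →L[ℂ] H} (hs : s ∈ vnFrom x N) : (s, s) ∈ pairs (op x) (op x ∘ g) := by
  rw [vnFrom_eq] at hs
  refine diag_mem_pairs (fun k => ?_) hs
  have := apply_mem_pairs (op x) (op x ∘ g) (N + k)
  rwa [Function.comp_apply, hg _ (Nat.le_add_right _ _)] at this

/-- An element of the algebra generated by the sequence involves only finitely many variables, so
it is fixed by substitutions that fix enough initial indices. -/
theorem exists_diag_mem_pairs_of_mem_adjoin {c : H →L[ℂ] H}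
    (hc : c ∈ Algebra.adjoin ℂ (Set.range (op x) ∪ star (Set.range (op x)))) :
    ∃ N, ∀ g : ℕ → ℕ, (∀ k < N, g k = k) → (c, c) ∈ pairs (op x) (op x ∘ g) := by
  have hgen : ∀ i, ∀ g : ℕ → ℕ, (∀ k < i + 1, g k = k) →
      (op x i, op x i) ∈ pairs (op x) (op x ∘ g) := by
    intro i g hg
    have := apply_mem_pairs (op x) (op x ∘ g) i
    rwa [Function.comp_apply, hg _ (Nat.lt_succ_self i)] at this
  induction hc using Algebra.adjoin_induction with
  | mem c hc =>
    rcases hc with ⟨i, rfl⟩ | ⟨i, hi⟩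
    · exact ⟨i + 1, hgen i⟩
    · rw [eq_comm, star_eq_iff_star_eq] at hi
      refine ⟨i + 1, fun g hg => ?_⟩
      rw [← hi]
      exact star_mem_pairs (hgen i g hg)
  | algebraMap z => exact ⟨0, fun g _ => by
      rw [Algebra.algebraMap_eq_smul_one]
      exact smul_mem_pairs z one_mem_pairs⟩
  | add c d _ _ h h' =>
    obtain ⟨N, hN⟩ := h
    obtain ⟨N', hN'⟩ := h'
    refine ⟨max N N', fun g hg => ?_⟩
    exact add_mem_pairs (hN g fun k hk => hg k (lt_max_of_lt_left hk))
      (hN' g fun k hk => hg k (lt_max_of_lt_right hk))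
  | mul c d _ _ h h' =>
    obtain ⟨N, hN⟩ := h
    obtain ⟨N', hN'⟩ := h'
    refine ⟨max N N', fun g hg => ?_⟩
    exact mul_mem_pairs (hN g fun k hk => hg k (lt_max_of_lt_left hk))
      (hN' g fun k hk => hg k (lt_max_of_lt_right hk))

/-- Tail elements are fixed by the shifts.  A tail element `s` has some image `s'` under the shift,
and for a polynomial `c` in the variables below `N`, the substitution fixing the indices below `N`
and shifting the others maps `c` to `c` and `s` to `s'`; so `φ (c s) = φ (c s')`, and such `c` are
dense. -/
theorem shift_mem_pairs_of_mem_tailAlgebra (hφ : IsFaithfulNormalState φ)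
    (hx : IsExchangeable φ x)
    (hω : ∀ a : A.toStarSubalgebra, normalFunctional ξ η (a : H →L[ℂ] H) = φ a)
    (n : ℕ) {s : H →L[ℂ] H} (hs : s ∈ tailAlgebra x) :
    (s, s) ∈ pairs (op x) (op x ∘ (n + ·)) := by
  have hsAll := mem_vnAll_of_mem_tailAlgebra hs
  obtain ⟨_, hC⟩ := exists_mem_pairs hsAll
  obtain ⟨s', hs', -⟩ := hC (op x ∘ (n + ·))
  have hs'All : s' ∈ vnAll x := by
    refine vnFrom_le_vnAll x n ?_
    rw [vnFrom_eq]
    exact snd_mem_generated_of_mem_pairs hs'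
  have key : ∀ c ∈ vnAll x, normalFunctional ξ η (c * (s - s')) = 0 := by
    intro c hc
    rw [normalFunctional_mul]
    refine normalFunctional_eq_zero_of_mem_generated ξ _ (fun c hc => ?_) hc
    rw [← normalFunctional_mul, mul_sub, map_sub, sub_eq_zero]
    obtain ⟨N, hN⟩ := exists_diag_mem_pairs_of_mem_adjoin hc
    let g : ℕ → ℕ := fun k => if k < N then k else n + k
    have hg : Function.Injective g := by
      intro k k' h
      simp only [g] at h
      split_ifs at h <;> omega
    have hsN := mem_vnFrom_of_mem_tailAlgebra hs N
    rw [vnFrom_eq] at hsN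
    obtain ⟨_, hC'⟩ := exists_mem_pairs hsN
    obtain ⟨s'', hs'', -⟩ := hC' fun k => op x (n + (N + k))
    have h1 : (s, s'') ∈ pairs (op x) (op x ∘ (n + ·)) :=
      pairs_le_pairs (fun k => apply_mem_pairs (op x) (op x ∘ (n + ·)) (N + k)) hs''
    have h2 : (s, s'') ∈ pairs (op x) (op x ∘ g) := by
      refine pairs_le_pairs (fun k => ?_) hs''
      have := apply_mem_pairs (op x) (op x ∘ g) (N + k)
      rwa [Function.comp_apply, show g (N + k) = n + (N + k) from if_neg (by omega)] at this
    have h3 : s' = s'' := snd_eq_of_mem_pairs hφ hx hω (add_right_injective n) hs' h1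
    have h4 : (c * s, c * s'') ∈ pairs (op x) (op x ∘ g) := by
      exact mul_mem_pairs (hN g fun k hk => if_pos hk) h2
    rw [normalFunctional_eq_of_mem_pairs hx hω hg h4, h3]
  have hsub : s - s' ∈ vnAll x := sub_mem hsAll hs'All
  have h0 := hφ.faithful ⟨s - s', mem_of_mem_vnAll hsub⟩
    ((hω _).symm.trans (key _ (star_mem hsub)))
  rwa [← sub_eq_zero.1 (congrArg Subtype.val h0)] at hs'

/-- A bounded sequence with `T j` in `vN(x_k | k ≥ j)` has a weak limit point in the tail
algebra. -/
theorem exists_mem_tailAlgebra_tendsto (ξ η : lp (fun _ : ℕ => H) 2) {T : ℕ → H →L[ℂ] H} {C : ℝ}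
    (hC : ∀ j, ‖T j‖ ≤ C) (hT : ∀ j, T j ∈ vnFrom x j) :
    ∃ b ∈ tailAlgebra x, ∀ s t, Tendsto (fun j => normalFunctional ξ η (s * T j * t))
      (hyperfilter ℕ) (𝓝 (normalFunctional ξ η (s * b * t))) := by
  obtain ⟨b, hb⟩ := exists_tendsto_inner_of_bounded (hyperfilter ℕ) T hC
  refine ⟨b, (mem_tailAlgebra_iff x b).2 fun m => ?_, tendsto_normalFunctional ξ η hC hb⟩
  have hev : ∀ᶠ j in (hyperfilter ℕ : Filter ℕ), T j ∈ vnFrom x m := by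
    have h1 : ∀ᶠ j in atTop, T j ∈ vnFrom x m := by
      filter_upwards [eventually_ge_atTop m] with j hj
      exact vnFrom_anti x hj (hT j)
    exact Nat.hyperfilter_le_atTop h1
  exact mem_of_tendsto_inner hb hev

/-- The defining property of the expectation: every `a` in `A_∞` is represented, under the
functionals `φ(s · t)` with `s`, `t` in the tail algebra, by a tail element, namely by a weak limit
point of its shifts. -/
theorem exists_mem_tailAlgebra_forall_eq (hφ : IsFaithfulNormalState φ) (hx : IsExchangeable φ x)
    (hω : ∀ a : A.toStarSubalgebra, normalFunctional ξ η (a : H →L[ℂ] H) = φ a)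
    {a : H →L[ℂ] H} (ha : a ∈ vnAll x) :
    ∃ b ∈ tailAlgebra x, ∀ s ∈ tailAlgebra x, ∀ t ∈ tailAlgebra x,
      normalFunctional ξ η (s * a * t) = normalFunctional ξ η (s * b * t) := by
  obtain ⟨C, hC⟩ := exists_mem_pairs ha
  choose T hT hTC using fun n : ℕ => hC (op x ∘ (n + ·))
  obtain ⟨b, hb, hlim⟩ := exists_mem_tailAlgebra_tendsto ξ η hTC fun j => by
    rw [vnFrom_eq]
    exact snd_mem_generated_of_mem_pairs (hT j)
  refine ⟨b, hb, fun s hs t ht => tendsto_nhds_unique ?_ (hlim s t)⟩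
  refine tendsto_const_nhds.congr fun n => ?_
  refine normalFunctional_eq_of_mem_pairs hx hω (add_right_injective n) ?_
  exact mul_mem_pairs
    (mul_mem_pairs (shift_mem_pairs_of_mem_tailAlgebra hφ hx hω n hs) (hT n))
    (shift_mem_pairs_of_mem_tailAlgebra hφ hx hω n ht)

theorem eq_of_forall_normalFunctional_eq (hφ : IsFaithfulNormalState φ)
    (hω : ∀ a : A.toStarSubalgebra, normalFunctional ξ η (a : H →L[ℂ] H) = φ a)
    {b b' : H →L[ℂ] H} (hb : b ∈ tailAlgebra x) (hb' : b' ∈ tailAlgebra x)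
    (h : ∀ s ∈ tailAlgebra x, ∀ t ∈ tailAlgebra x,
      normalFunctional ξ η (s * b * t) = normalFunctional ξ η (s * b' * t)) : b = b' := by
  have hsub : b - b' ∈ tailAlgebra x := sub_mem hb hb'
  have h1 := h _ (star_mem hsub) 1 (one_mem _)
  rw [mul_one, mul_one, ← sub_eq_zero, ← map_sub, ← mul_sub] at h1
  have h0 := hφ.faithful ⟨b - b', mem_of_mem_vnAll (mem_vnAll_of_mem_tailAlgebra hsub)⟩
    ((hω _).symm.trans h1)
  exact sub_eq_zero.1 (congrArg Subtype.val h0)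

theorem IsTailCondExp.normalFunctional_eq
    (hω : ∀ a : A.toStarSubalgebra, normalFunctional ξ η (a : H →L[ℂ] H) = φ a)
    {E : (vnAll x).toStarSubalgebra →ₗ[ℂ] (tailAlgebra x).toStarSubalgebra}
    (hE : IsTailCondExp φ x E) (a : (vnAll x).toStarSubalgebra) {s t : H →L[ℂ] H}
    (hs : s ∈ tailAlgebra x) (ht : t ∈ tailAlgebra x) :
    normalFunctional ξ η (s * a * t) = normalFunctional ξ η (s * E a * t) := by
  have h := hE.preserving (inclTail x ⟨s, hs⟩ * a * inclTail x ⟨t, ht⟩)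
  rw [hE.bimodule, ← hω, ← hω] at h
  exact h.symm

theorem existsUnique_isTailCondExp (hφ : IsFaithfulNormalState φ) (hx : IsExchangeable φ x) :
    ∃! E, IsTailCondExp φ x E := by
  obtain ⟨ξ, η, hω⟩ := hφ.exists_normalFunctional
  have huniq := fun (b b' : (tailAlgebra x).toStarSubalgebra) h => Subtype.ext
    (eq_of_forall_normalFunctional_eq hφ hω b.2 b'.2 h)
  have hex : ∀ a : (vnAll x).toStarSubalgebra, ∃ b : (tailAlgebra x).toStarSubalgebra,
      ∀ s ∈ tailAlgebra x, ∀ t ∈ tailAlgebra x,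
      normalFunctional ξ η (s * a * t) = normalFunctional ξ η (s * b * t) := fun a => by
    obtain ⟨b, hb, h⟩ := exists_mem_tailAlgebra_forall_eq hφ hx hω a.2
    exact ⟨⟨b, hb⟩, h⟩
  choose e he using hex
  let E : (vnAll x).toStarSubalgebra →ₗ[ℂ] (tailAlgebra x).toStarSubalgebra :=
    { toFun := e
      map_add' := fun a a' => huniq _ _ fun s hs t ht => by
        rw [← he _ s hs t ht]
        simp only [AddMemClass.coe_add, mul_add, add_mul, map_add, he _ s hs t ht]
      map_smul' := fun c a => huniq _ _ fun s hs t ht => by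
        rw [← he _ s hs t ht]
        simp only [SetLike.val_smul, mul_smul_comm, smul_mul_assoc, map_smul, he _ s hs t ht,
          RingHom.id_apply] }
  refine ⟨E, ⟨fun b => huniq _ _ fun s hs t ht => (he _ s hs t ht).symm,
    fun b₁ a b₂ => huniq _ _ fun s hs t ht => ?_, fun a => ?_⟩, fun E' hE' => ?_⟩
  · refine (he _ s hs t ht).symm.trans ?_
    have := he a (s * b₁) (mul_mem hs b₁.2) (b₂ * t) (mul_mem b₂.2 ht)
    change normalFunctional ξ η (s * ((b₁ : H →L[ℂ] H) * a * b₂) * t) =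
      normalFunctional ξ η (s * ((b₁ : H →L[ℂ] H) * e a * b₂) * t)
    simpa only [mul_assoc] using this
  · have := he a 1 (one_mem _) 1 (one_mem _)
    rw [one_mul, one_mul, mul_one, mul_one] at this
    rw [← hω, ← hω]
    exact this.symm
  · refine LinearMap.ext fun a => huniq _ _ fun s hs t ht => ?_
    rw [← hE'.normalFunctional_eq hω a hs ht]
    exact he a s hs t ht

end TailAlgebra

section Factorization

/-! ### Factorization of products of polynomials -/

/-- Induction principle for operator-valued polynomials. -/
theorem OpPoly.induction {B : Type*} [Ring B] [Algebra ℂ B] {P : OpPoly B → Prop}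
    (const : ∀ b, P (OpPoly.const b)) (X : P (OpPoly.X B))
    (add : ∀ p q, P p → P q → P (p + q)) (mul : ∀ p q, P p → P q → P (p * q)) (p : OpPoly B) :
    P p := by
  obtain ⟨q, rfl⟩ := RingQuot.mkAlgHom_surjective ℂ (PolyRel B) p
  induction q using FreeAlgebra.induction with
  | grade0 z =>
    rw [← RingQuot.mkAlgHom_rel ℂ (PolyRel.scalar z)]
    exact const _
  | grade1 o =>
    cases o with
    | none => exact X
    | some b => exact const b
  | mul p q hp hq => rw [map_mul]; exact mul _ _ hp hq
  | add p q hp hq => rw [map_add]; exact add _ _ hp hq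

/-- Replacing the `l`-th factor of a product. -/
theorem exists_prod_ofFn_update {R : Type*} [Monoid R] (S : Submonoid R) :
    ∀ (n : ℕ) (F : Fin n → R) (l : Fin n), (∀ r, r ≠ l → F r ∈ S) →
      ∃ w₁ ∈ S, ∃ w₂ ∈ S, ∀ v, (List.ofFn (Function.update F l v)).prod = w₁ * v * w₂ := by
  intro n
  induction n with
  | zero => exact fun _ l => l.elim0
  | succ n ih =>
    intro F l
    induction l using Fin.cases with
    | zero =>
      intro hF
      refine ⟨1, S.one_mem, (List.ofFn fun r : Fin n => F r.succ).prod,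
        S.list_prod_mem fun y hy => ?_, fun v => ?_⟩
      · obtain ⟨r, rfl⟩ := (List.mem_ofFn' _ _).1 hy
        exact hF _ (Fin.succ_ne_zero r)
      · rw [List.ofFn_succ, List.prod_cons]
        simp
    | succ l =>
      intro hF
      obtain ⟨w₁, h₁, w₂, h₂, h⟩ := ih (fun r => F r.succ) l fun r hr =>
        hF _ fun h => hr (Fin.succ_injective _ h)
      refine ⟨F 0 * w₁, S.mul_mem (hF 0 (Fin.succ_ne_zero l).symm) h₁, w₂, h₂, fun v => ?_⟩
      have : (fun r : Fin n => Function.update F l.succ v r.succ) =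
          Function.update (fun r => F r.succ) l v := by
        ext r
        by_cases hr : r = l
        · subst hr; simp
        · simp [hr]
      rw [List.ofFn_succ, List.prod_cons, this, h,
        Function.update_of_ne (Fin.succ_ne_zero l).symm]
      simp only [mul_assoc]

variable {H : Type*} [NormedAddCommGroup H] [InnerProductSpace ℂ H] [CompleteSpace H]
  {A : VonNeumannAlgebra H} {φ : A.toStarSubalgebra →ₗ[ℂ] ℂ} {x : ℕ → A.toStarSubalgebra}
  {ξ η : lp (fun _ : ℕ => H) 2}

theorem polyAt_mem_vnFrom (p : OpPoly (tailAlgebra x).toStarSubalgebra) (i : ℕ) :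
    (polyAt x p i : H →L[ℂ] H) ∈ vnFrom x i := by
  induction p using OpPoly.induction with
  | const b =>
    rw [polyAt, OpPoly.eval_const]
    exact mem_vnFrom_of_mem_tailAlgebra b.2 i
  | X =>
    rw [polyAt, OpPoly.eval_X]
    exact subset_generated _ ⟨i, le_rfl, rfl⟩
  | add p q hp hq =>
    rw [polyAt, map_add]
    exact add_mem hp hq
  | mul p q hp hq =>
    rw [polyAt, map_mul]
    exact mul_mem hp hq

/-- A substitution of finitely many indices fixes the coefficients of a tail-algebra-valued
polynomial and acts on its variable. -/
theorem polyAt_mem_pairs {g : ℕ → ℕ} {N : ℕ} (hg : ∀ k, N ≤ k → g k = k)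
    (p : OpPoly (tailAlgebra x).toStarSubalgebra) (i : ℕ) :
    ((polyAt x p i : H →L[ℂ] H), (polyAt x p (g i) : H →L[ℂ] H)) ∈ pairs (op x) (op x ∘ g) := by
  induction p using OpPoly.induction with
  | const b =>
    rw [polyAt, polyAt, OpPoly.eval_const, OpPoly.eval_const]
    exact diag_mem_pairs_of_eventually_fixed hg (mem_vnFrom_of_mem_tailAlgebra b.2 N)
  | X =>
    rw [polyAt, polyAt, OpPoly.eval_X, OpPoly.eval_X]
    exact apply_mem_pairs (op x) (op x ∘ g) i
  | add p q hp hq =>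
    rw [polyAt, polyAt, map_add, map_add]
    exact add_mem_pairs hp hq
  | mul p q hp hq =>
    rw [polyAt, polyAt, map_mul, map_mul]
    exact mul_mem_pairs hp hq

/-- The elements of `A_∞` fixed by the transpositions of `i` with all indices `j ≥ N`. -/
def fixedBySwap (x : ℕ → A.toStarSubalgebra) (i N : ℕ) : Submonoid (vnAll x).toStarSubalgebra where
  carrier := {w | ∀ j, N ≤ j →
    ((w : H →L[ℂ] H), (w : H →L[ℂ] H)) ∈ pairs (op x) (op x ∘ Equiv.swap i j)}
  one_mem' := fun _ _ => one_mem_pairs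
  mul_mem' := fun h h' j hj => mul_mem_pairs (h j hj) (h' j hj)

theorem swap_apply_of_max_lt (i j k : ℕ) (hk : max i j + 1 ≤ k) : Equiv.swap i j k = k :=
  Equiv.swap_apply_of_ne_of_ne (by omega) (by omega)

/-- Exchanging `i` with `j → ∞` replaces `p(x_i)` by `p(x_j)`, which converges weakly to
`E[p(x_i)]`, and changes neither the tail elements nor the factors not involving `x_i`. -/
theorem IsTailCondExp.map_mul_polyAt_mul (hφ : IsFaithfulNormalState φ) (hx : IsExchangeable φ x)
    {E : (vnAll x).toStarSubalgebra →ₗ[ℂ] (tailAlgebra x).toStarSubalgebra}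
    (hE : IsTailCondExp φ x E) (p : OpPoly (tailAlgebra x).toStarSubalgebra) {i N : ℕ}
    {w₁ w₂ : (vnAll x).toStarSubalgebra} (h₁ : w₁ ∈ fixedBySwap x i N)
    (h₂ : w₂ ∈ fixedBySwap x i N) :
    E (w₁ * polyAt x p i * w₂) = E (w₁ * inclTail x (E (polyAt x p i)) * w₂) := by
  obtain ⟨ξ, η, hω⟩ := hφ.exists_normalFunctional
  have hpair : ∀ j, ((polyAt x p i : H →L[ℂ] H), (polyAt x p j : H →L[ℂ] H)) ∈
      pairs (op x) (op x ∘ Equiv.swap i j) := by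
    intro j
    have := polyAt_mem_pairs (swap_apply_of_max_lt i j) p i
    rwa [Equiv.swap_apply_left] at this
  have htail : ∀ j, ∀ s ∈ tailAlgebra x, (s, s) ∈ pairs (op x) (op x ∘ Equiv.swap i j) :=
    fun j s hs => diag_mem_pairs_of_eventually_fixed (swap_apply_of_max_lt i j)
      (mem_vnFrom_of_mem_tailAlgebra hs _)
  have hbound : ∃ C : ℝ, ∀ j, ‖(polyAt x p j : H →L[ℂ] H)‖ ≤ C := by
    obtain ⟨C, hC⟩ := exists_mem_pairs (polyAt x p i).2
    refine ⟨C, fun j => ?_⟩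
    obtain ⟨b, hb, hbC⟩ := hC (op x ∘ Equiv.swap i j)
    rwa [snd_eq_of_mem_pairs hφ hx hω (Equiv.injective _) (hpair j) hb]
  obtain ⟨C, hC⟩ := hbound
  obtain ⟨b, hb, hlim⟩ := exists_mem_tailAlgebra_tendsto ξ η hC (polyAt_mem_vnFrom p)
  have hbE : b = E (polyAt x p i) := by
    refine eq_of_forall_normalFunctional_eq hφ hω hb (E (polyAt x p i)).2 fun s hs t ht => ?_
    rw [← hE.normalFunctional_eq hω _ hs ht]
    refine tendsto_nhds_unique (hlim s t) (tendsto_const_nhds.congr fun j => ?_)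
    refine normalFunctional_eq_of_mem_pairs hx hω (Equiv.swap i j).injective ?_
    exact mul_mem_pairs (mul_mem_pairs (htail j s hs) (hpair j)) (htail j t ht)
  refine Subtype.ext (eq_of_forall_normalFunctional_eq hφ hω (E _).2 (E _).2 fun s hs t ht => ?_)
  rw [← hE.normalFunctional_eq hω _ hs ht, ← hE.normalFunctional_eq hω _ hs ht]
  have e : ∀ c : H →L[ℂ] H, s * ((w₁ : H →L[ℂ] H) * c * w₂) * t = (s * w₁) * c * (w₂ * t) :=
    fun c => by simp only [mul_assoc]
  change normalFunctional ξ η (s * ((w₁ : H →L[ℂ] H) * polyAt x p i * w₂) * t) =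
    normalFunctional ξ η (s * ((w₁ : H →L[ℂ] H) * E (polyAt x p i) * w₂) * t)
  rw [e, e, ← hbE]
  refine tendsto_nhds_unique (tendsto_const_nhds.congr' ?_) (hlim (s * w₁) (w₂ * t))
  refine Nat.hyperfilter_le_atTop ?_
  filter_upwards [eventually_ge_atTop N] with j hj
  refine normalFunctional_eq_of_mem_pairs hx hω (Equiv.swap i j).injective ?_
  exact mul_mem_pairs (mul_mem_pairs (mul_mem_pairs (htail j s hs) (h₁ j hj)) (hpair j))
    (mul_mem_pairs (h₂ j hj) (htail j t ht))

end Factorization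

end TailFactorization

end

theorem proposition4p4 {H : Type*} [NormedAddCommGroup H] [InnerProductSpace ℂ H]
    [CompleteSpace H] (A : VonNeumannAlgebra H) (φ : A.toStarSubalgebra →ₗ[ℂ] ℂ)
    (hφ : TailFactorization.IsFaithfulNormalState φ)
    (x : ℕ → A.toStarSubalgebra) (hx : TailFactorization.IsExchangeable φ x) :
    (∃! E, TailFactorization.IsTailCondExp φ x E) ∧
    ∀ E, TailFactorization.IsTailCondExp φ x E →
      ∀ (n : ℕ) (p : Fin n → TailFactorization.OpPoly
            (TailFactorization.tailAlgebra x).toStarSubalgebra)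
        (i : Fin n → ℕ) (l : Fin n), (∀ r, r ≠ l → i r ≠ i l) →
        E (List.ofFn fun r => TailFactorization.polyAt x (p r) (i r)).prod =
          E (List.ofFn (Function.update
              (fun r => TailFactorization.polyAt x (p r) (i r)) l
              (TailFactorization.inclTail x
                (E (TailFactorization.polyAt x (p l) (i l)))))).prod := by
  refine ⟨TailFactorization.existsUnique_isTailCondExp hφ hx, fun E hE n p i l hi => ?_⟩
  -- `N` exceeds all the indices that occur
  obtain ⟨N, hN⟩ : ∃ N, ∀ r, i r < N :=
    ⟨Finset.univ.sup i + 1, fun r => Nat.lt_succ_of_le (Finset.le_sup (Finset.mem_univ r))⟩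
  obtain ⟨w₁, h₁, w₂, h₂, h⟩ := TailFactorization.exists_prod_ofFn_update
    (TailFactorization.fixedBySwap x (i l) N) n
    (fun r => TailFactorization.polyAt x (p r) (i r)) l fun r hr j hj => by
      have := TailFactorization.polyAt_mem_pairs
        (TailFactorization.swap_apply_of_max_lt (i l) j) (p r) (i r)
      rwa [Equiv.swap_apply_of_ne_of_ne (hi r hr) ((hN r).trans_le hj).ne] at this
  have h0 := h (TailFactorization.polyAt x (p l) (i l))
  rw [Function.update_eq_self] at h0
  rw [h0, h]
  exact hE.map_mul_polyAt_mul hφ hx (p l) h₁ h₂
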